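/- Let $A$ and $B$ be (not necessarily unital) complex $C^*$-algebras and let $\varepsilon\ge 0$. For a $C^*$-algebra $D$, call a bounded linear map $\psi\colon D\to E$ into a $C^*$-algebra $E$ \emph{$\varepsilon$-order zero} if $\|\psi(x)\psi(y)\|\le\varepsilon\|x\|\,\|y\|$ for all positive $x,y\in D$ with $x\perp y$, where $x\perp y$ means $xy=yx=x^*y=xy^*=0$. Let $\varphi\colon A\to B$ be a bounded linear $\varepsilon$-order zero map and let $\varphi^{**}\colon A^{**}\to B^{**}$ be its second adjoint, where $B^{**}$ carries its norm as a bidual space and the Arens product, $(xy)(\xi)=x\bigl(b\mapsto y(c\mapsto\xi(bc))\bigr)$ for $x,y\in B^{**}$, $\xi\in B^*$ (this is the usual $C^*$-algebra structure of $B^{**}$). Let $A_0\subseteq A$ be a commutative separable $C^*$-subalgebra with spectrum (character space) $\sigma(A_0)$, and let $B(\sigma(A_0))$ be the $C^*$-algebra of bounded complex-valued Borel functions on $\sigma(A_0)$ with the supremum norm, regarded as a subalgebra of $A^{**}$ via $f\mapsto\bigl(\psi\mapsto\int_{\sigma(A_0)}f\,d\mu_\psi\bigr)$, where, for $\psi\in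 A^*$, $\mu_\psi$ is the unique complex Borel measure on $\sigma(A_0)$ with $\psi(a)=\int_{\sigma(A_0)}\chi(a)\,d\mu_\psi(\chi)$ for all $a\in A_0$. Then the restriction $\varphi^{**}\!\restriction_{B(\sigma(A_0))}\colon B(\sigma(A_0))\to B^{**}$ is $\varepsilon$-order zero. -/

import Mathlib

noncomputable section

open MeasureTheory WeakDual ComplexConjugate
open scoped ENNReal

/-! ### Riesz representation on a compact space -/

theorem exists_measure_of_pos {K : Type*} [TopologicalSpace K] [CompactSpace K] [T2Space K]
    [MeasurableSpace K] [BorelSpace K] (P : C(K, ℝ) →ₗ[ℝ] ℝ) (hP : ∀ h, 0 ≤ h → 0 ≤ P h) :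
    ∃ μ : Measure K, IsFiniteMeasure μ ∧ ∀ h : C(K, ℝ), P h = ∫ x, h x ∂μ := by
  let Λ : CompactlySupportedContinuousMap K ℝ →ₚ[ℝ] ℝ :=
  { toFun g := P g.toContinuousMap
    map_add' g g' := P.map_add _ _
    map_smul' c g := P.map_smul _ _
    monotone' g g' hgg' := by
      have := hP (g'.toContinuousMap - g.toContinuousMap) (fun x => sub_nonneg.2 (hgg' x))
      rw [map_sub] at this
      exact sub_nonneg.1 this }
  refine ⟨RealRMK.rieszMeasure Λ, inferInstance, fun h => ?_⟩
  exact (RealRMK.integral_rieszMeasure Λ ⟨h, HasCompactSupport.of_compactSpace _⟩).symm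

theorem exists_measures_of_bounded {K : Type*} [TopologicalSpace K] [CompactSpace K] [T2Space K]
    [MeasurableSpace K] [BorelSpace K] (L : C(K, ℝ) →ₗ[ℝ] ℝ) (M : ℝ) (hM : 0 ≤ M)
    (hL : ∀ h, L h ≤ M * ‖h‖) :
    ∃ μ ν : Measure K, IsFiniteMeasure μ ∧ IsFiniteMeasure ν ∧ μ.real Set.univ ≤ M ∧
      ν.real Set.univ ≤ M ∧ ∀ h : C(K, ℝ), L h = ∫ x, h x ∂μ - ∫ x, h x ∂ν := by
  let N : C(K, ℝ) × C(K, ℝ) → ℝ := fun p => M * max ‖p.1 ⊔ 0‖ ‖p.2 ⊔ 0‖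
  have norm_le (h : C(K, ℝ)) (c : ℝ) (hc : 0 ≤ c) (hh : ∀ x, h x ≤ c) : ‖h ⊔ 0‖ ≤ c := by
    refine (ContinuousMap.norm_le _ hc).2 fun x => ?_
    rw [Real.norm_eq_abs, abs_of_nonneg (by simp)]
    simp [hh x, hc]
  have le_norm (h : C(K, ℝ)) (x : K) : h x ≤ ‖h ⊔ 0‖ :=
    (le_max_left (h x) 0).trans ((le_abs_self _).trans ((h ⊔ 0).norm_coe_le_norm x))
  let D : Submodule ℝ (C(K, ℝ) × C(K, ℝ)) :=
    LinearMap.ker (LinearMap.fst ℝ C(K, ℝ) C(K, ℝ) + LinearMap.snd ℝ C(K, ℝ) C(K, ℝ))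
  let f : (C(K, ℝ) × C(K, ℝ)) →ₗ.[ℝ] ℝ :=
    ⟨D, L ∘ₗ (LinearMap.fst ℝ C(K, ℝ) C(K, ℝ)) ∘ₗ D.subtype⟩
  obtain ⟨g, hg, hgN⟩ := exists_extension_of_le_sublinear f N
    (by
      intro c hc p
      have key (h : C(K, ℝ)) : ‖(c • h) ⊔ 0‖ = c * ‖h ⊔ 0‖ := by
        have : (c • h) ⊔ 0 = c • (h ⊔ 0) := by
          ext x
          simp [mul_max_of_nonneg _ _ hc.le]
        rw [this, norm_smul, Real.norm_eq_abs, abs_of_pos hc]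
      simp only [N, Prod.smul_fst, Prod.smul_snd, key]
      rw [← mul_max_of_nonneg _ _ hc.le]
      ring)
    (by
      intro p q
      simp only [N, Prod.fst_add, Prod.snd_add]
      rw [← mul_add]
      refine mul_le_mul_of_nonneg_left (max_le ?_ ?_) hM
      · refine norm_le _ _ (by positivity) fun x => ?_
        exact add_le_add ((le_norm _ x).trans (le_max_left _ _))
          ((le_norm _ x).trans (le_max_left _ _))
      · refine norm_le _ _ (by positivity) fun x => ?_
        exact add_le_add ((le_norm _ x).trans (le_max_right _ _))
          ((le_norm _ x).trans (le_max_right _ _)))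
    (by
      rintro ⟨⟨u, v⟩, huv⟩
      have huv' : u + v = 0 := huv
      obtain rfl : v = -u := (neg_eq_of_add_eq_zero_right huv').symm
      refine (hL u).trans (mul_le_mul_of_nonneg_left ?_ hM)
      refine (ContinuousMap.norm_le _ (by positivity)).2 fun x => ?_
      rw [Real.norm_eq_abs]
      refine abs_le'.2 ⟨(le_norm _ x).trans (le_max_left _ _), ?_⟩
      exact (le_norm (-u) x).trans (le_max_right _ _))
  have hpos (p : C(K, ℝ) × C(K, ℝ)) (h1 : 0 ≤ p.1) (h2 : 0 ≤ p.2) : 0 ≤ g p := by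
    have := hgN (-p)
    have e1 : (-p).1 ⊔ 0 = 0 := sup_eq_right.2 (by simpa using h1)
    have e2 : (-p).2 ⊔ 0 = 0 := sup_eq_right.2 (by simpa using h2)
    simp only [N, e1, e2, map_neg, norm_zero, max_self, mul_zero] at this
    linarith
  obtain ⟨μ, hμ, hμ'⟩ := exists_measure_of_pos (g ∘ₗ LinearMap.inl ℝ C(K, ℝ) C(K, ℝ))
    (fun h hh => hpos _ hh le_rfl)
  obtain ⟨ν, hν, hν'⟩ := exists_measure_of_pos (g ∘ₗ LinearMap.inr ℝ C(K, ℝ) C(K, ℝ))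
    (fun h hh => hpos _ le_rfl hh)
  have one_le : ‖(1 : C(K, ℝ)) ⊔ 0‖ ≤ 1 := norm_le _ _ zero_le_one fun x => le_rfl
  refine ⟨μ, ν, hμ, hν, ?_, ?_, fun h => ?_⟩
  · have h1 := hμ' 1
    have h2 := hgN (1, 0)
    simp only [LinearMap.comp_apply, LinearMap.inl_apply, ContinuousMap.one_apply,
      integral_const, smul_eq_mul, mul_one] at h1
    rw [← h1]
    refine h2.trans ?_
    simp only [N]
    calc _ ≤ M * 1 := by gcongr; simpa using one_le
      _ = M := mul_one M
  · have h1 := hν' 1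
    have h2 := hgN (0, 1)
    simp only [LinearMap.comp_apply, LinearMap.inr_apply, ContinuousMap.one_apply,
      integral_const, smul_eq_mul, mul_one] at h1
    rw [← h1]
    refine h2.trans ?_
    simp only [N]
    calc _ ≤ M * 1 := by gcongr; simpa using one_le
      _ = M := mul_one M
  · have h0 := hg ⟨(h, -h), by simp [f, D]⟩
    have h1 : g (h, -h) = L h := h0
    rw [← hμ', ← hν', ← h1]
    simp only [LinearMap.comp_apply, ← map_sub]
    simp

/-! ### The spectrum of a commutative C⋆-algebra -/

instance characterSpace.instMeasurableSpace {C : Type*} [NonUnitalCommCStarAlgebra C] :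
    MeasurableSpace (characterSpace ℂ C) := borel _

instance characterSpace.instBorelSpace {C : Type*} [NonUnitalCommCStarAlgebra C] :
    BorelSpace (characterSpace ℂ C) := ⟨rfl⟩

/-- The extension of a character to the unitization. -/
def charExt {C : Type*} [NonUnitalCommCStarAlgebra C] (χ : characterSpace ℂ C) :
    characterSpace ℂ (Unitization ℂ C) :=
  CharacterSpace.equivAlgHom.symm (Unitization.lift (CharacterSpace.toNonUnitalAlgHom χ))

section

variable {C : Type*} [NonUnitalCommCStarAlgebra C]

theorem char_apply (κ : characterSpace ℂ (Unitization ℂ C)) (z : Unitization ℂ C) :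
    κ z = z.fst + κ (z.snd : Unitization ℂ C) := by
  conv_lhs => rw [← Unitization.inl_fst_add_inr_snd_eq z]
  rw [map_add]
  congr 1
  have := AlgHomClass.commutes κ z.fst
  simpa [Unitization.algebraMap_eq_inl] using this

theorem charExt_inr (χ : characterSpace ℂ C) (a : C) :
    charExt χ (a : Unitization ℂ C) = χ a := by
  simp [charExt]

/-- The restriction of a character of the unitization. -/
def charRes (κ : characterSpace ℂ (Unitization ℂ C)) : WeakDual ℂ C :=
  StrongDual.toWeakDual ((CharacterSpace.toCLM κ).comp
    (⟨Unitization.inrHom ℂ ℂ C, Unitization.continuous_inr⟩ :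
      C →L[ℂ] Unitization ℂ C))

theorem charRes_apply (κ : characterSpace ℂ (Unitization ℂ C)) (a : C) :
    charRes κ a = κ (a : Unitization ℂ C) := rfl

theorem continuous_charRes :
    Continuous (charRes : characterSpace ℂ (Unitization ℂ C) → WeakDual ℂ C) :=
  continuous_of_continuous_eval fun a =>
    (WeakDual.eval_continuous (a : Unitization ℂ C)).comp continuous_subtype_val

theorem charRes_charExt (χ : characterSpace ℂ C) : charRes (charExt χ) = (χ : WeakDual ℂ C) :=
  DFunLike.ext _ _ fun a => charExt_inr χ a

theorem continuous_charExt :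
    Continuous (charExt : characterSpace ℂ C → characterSpace ℂ (Unitization ℂ C)) := by
  refine Continuous.subtype_mk (continuous_of_continuous_eval fun z => ?_) _
  have : (fun χ : characterSpace ℂ C => charExt χ z) = fun χ =>
      z.fst + χ z.snd := by
    funext χ
    rw [char_apply, charExt_inr]
  exact (continuous_const.add ((WeakDual.eval_continuous z.snd).comp continuous_subtype_val)).congr
    fun χ => (congrFun this χ).symm

theorem mem_range_charExt {κ : characterSpace ℂ (Unitization ℂ C)} (h : charRes κ ≠ 0) :
    κ ∈ Set.range (charExt : characterSpace ℂ C → _) := by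
  refine ⟨⟨charRes κ, h, fun a b => ?_⟩, ?_⟩
  · simp [charRes_apply]
  · refine CharacterSpace.ext fun z => ?_
    rw [char_apply, char_apply κ, charExt_inr]; rfl

theorem range_charExt :
    Set.range (charExt : characterSpace ℂ C → characterSpace ℂ (Unitization ℂ C)) =
      charRes ⁻¹' {0}ᶜ := by
  ext κ
  refine ⟨?_, mem_range_charExt⟩
  rintro ⟨χ, rfl⟩
  simpa [charRes_charExt] using χ.2.1

theorem measurableEmbedding_charExt :
    MeasurableEmbedding (charExt : characterSpace ℂ C → characterSpace ℂ (Unitization ℂ C)) := by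
  have h1 : Topology.IsEmbedding
      (charRes ∘ (charExt : characterSpace ℂ C → characterSpace ℂ (Unitization ℂ C))) := by
    have : charRes ∘ (charExt : characterSpace ℂ C → characterSpace ℂ (Unitization ℂ C)) =
      Subtype.val := funext charRes_charExt
    rw [this]; exact Topology.IsEmbedding.subtypeVal
  refine (Topology.IsEmbedding.of_comp continuous_charExt continuous_charRes h1).measurableEmbedding
    ?_
  rw [range_charExt]
  exact (isOpen_compl_singleton.preimage continuous_charRes).measurableSet

/-- The character of the unitization which vanishes on `C`. -/
def charInfty (C : Type*) [NonUnitalCommCStarAlgebra C] : characterSpace ℂ (Unitization ℂ C) :=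
  CharacterSpace.equivAlgHom.symm (Unitization.fstHom ℂ C)

theorem charInfty_apply (z : Unitization ℂ C) : charInfty C z = z.fst := rfl

theorem charInfty_notMem : charInfty C ∉ Set.range (charExt : characterSpace ℂ C → _) := by
  rw [range_charExt]
  simp only [Set.mem_preimage, Set.mem_compl_iff, Set.mem_singleton_iff, not_not]
  exact DFunLike.ext _ _ fun a => by
    rw [charRes_apply, charInfty_apply]; simp; rfl

theorem continuous_char_apply (a : C) : Continuous fun χ : characterSpace ℂ C => χ a :=
  (WeakDual.eval_continuous a).comp continuous_subtype_val

theorem norm_char_apply_le (χ : characterSpace ℂ C) (a : C) : ‖χ a‖ ≤ ‖a‖ := by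
  rw [← charExt_inr, ← Unitization.norm_inr (𝕜 := ℂ) a]
  exact spectrum.norm_le_norm_of_mem (CharacterSpace.apply_mem_spectrum _ _)

theorem char_star (χ : characterSpace ℂ C) (a : C) : χ (star a) = conj (χ a) := by
  rw [← charExt_inr χ, ← charExt_inr χ, Unitization.inr_star, map_star]
  rfl

theorem integrable_char (a : C) (μ : Measure (characterSpace ℂ C)) [IsFiniteMeasure μ] :
    Integrable (fun χ : characterSpace ℂ C => χ a) μ :=
  Integrable.of_bound (continuous_char_apply a).aestronglyMeasurable ‖a‖
    (ae_of_all _ fun χ => norm_char_apply_le χ a)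

/-- Finite Borel measures on the spectrum are determined by the integrals of Gelfand transforms. -/
theorem measure_ext_of_char [TopologicalSpace.SeparableSpace C]
    (μ ν : Measure (characterSpace ℂ C)) [IsFiniteMeasure μ] [IsFiniteMeasure ν]
    (h : ∀ a : C, ∫ χ, χ a ∂μ = ∫ χ, χ a ∂ν) : μ = ν := by
  have : TopologicalSpace.SeparableSpace (Unitization ℂ C) := by
    have hd : DenseRange (fun p : ℂ × C => (Unitization.inl p.1 + (p.2 : Unitization ℂ C))) :=
      Function.Surjective.denseRange fun z => ⟨(z.fst, z.snd), Unitization.inl_fst_add_inr_snd_eq z⟩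
    refine hd.separableSpace ?_
    have h1 : Continuous (fun c : ℂ => (Unitization.inl c : Unitization ℂ C)) := by
      simpa [← Unitization.algebraMap_eq_inl] using continuous_algebraMap ℂ (Unitization ℂ C)
    exact (h1.comp continuous_fst).add (Unitization.continuous_inr.comp continuous_snd)
  have : TopologicalSpace.MetrizableSpace (characterSpace ℂ (Unitization ℂ C)) :=
    WeakDual.metrizable_of_isCompact ℂ _ _ (isCompact_iff_compactSpace.2 inferInstance)
  let _ : MetricSpace (characterSpace ℂ (Unitization ℂ C)) := TopologicalSpace.metrizableSpaceMetric _
  have hj := measurableEmbedding_charExt (C := C)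
  let μ' := μ.map charExt + ν Set.univ • Measure.dirac (charInfty C)
  let ν' := ν.map charExt + μ Set.univ • Measure.dirac (charInfty C)
  have : IsFiniteMeasure (ν Set.univ • Measure.dirac (charInfty C)) :=
    Measure.smul_finite _ (measure_ne_top _ _)
  have : IsFiniteMeasure (μ Set.univ • Measure.dirac (charInfty C)) :=
    Measure.smul_finite _ (measure_ne_top _ _)
  have key (ρ ρ' : Measure (characterSpace ℂ C)) [IsFiniteMeasure ρ] [IsFiniteMeasure ρ']
      (z : Unitization ℂ C) :
      ∫ κ, κ z ∂(ρ.map charExt + ρ' Set.univ • Measure.dirac (charInfty C)) =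
        (ρ.real Set.univ + ρ'.real Set.univ : ℝ) * z.fst + ∫ χ, χ z.snd ∂ρ := by
    have : IsFiniteMeasure (ρ' Set.univ • Measure.dirac (charInfty C)) :=
      Measure.smul_finite _ (measure_ne_top _ _)
    have hi (m : Measure (characterSpace ℂ (Unitization ℂ C))) [IsFiniteMeasure m] :
        Integrable (fun κ : characterSpace ℂ (Unitization ℂ C) => κ z) m :=
      (gelfandTransform ℂ (Unitization ℂ C) z).continuous.integrable_of_hasCompactSupport
        (HasCompactSupport.of_compactSpace _)
    rw [integral_add_measure (hi _) (hi _), hj.integral_map, integral_smul_measure,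
      integral_dirac, charInfty_apply]
    have : ∀ χ : characterSpace ℂ C, charExt χ z = z.fst + χ z.snd := fun χ => by
      rw [char_apply, charExt_inr]
    simp only [this]
    rw [integral_add (integrable_const _) (integrable_char _ _), integral_const]
    simp only [Measure.real, Complex.real_smul]
    push_cast
    ring
  have e : μ' = ν' := by
    refine ext_of_forall_integral_eq_of_IsFiniteMeasure fun f => ?_
    obtain ⟨z, hz⟩ := (gelfandTransform_bijective (Unitization ℂ C)).2
      ⟨fun κ => (f κ : ℂ), by fun_prop⟩
    have hz' (κ : characterSpace ℂ (Unitization ℂ C)) : ((f κ : ℝ) : ℂ) = κ z :=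
      (DFunLike.congr_fun hz κ).symm
    have : (∫ κ, ((f κ : ℝ) : ℂ) ∂μ') = ∫ κ, ((f κ : ℝ) : ℂ) ∂ν' := by
      simp only [hz', μ', ν', key, h]
      rw [add_comm (μ.real _)]
    rw [integral_complex_ofReal, integral_complex_ofReal] at this
    exact_mod_cast this
  have hc (ρ : Measure (characterSpace ℂ C)) (c : ℝ≥0∞) :
      (ρ.map charExt + c • Measure.dirac (charInfty C)).comap charExt = ρ := by
    ext s hs
    rw [hj.comap_apply]
    have : MeasurableSet (charExt '' s) := hj.measurableSet_image.2 hs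
    simp only [Measure.add_apply, Measure.smul_apply, smul_eq_mul, hj.map_apply,
      hj.injective.preimage_image]
    rw [Measure.dirac_apply' _ this, Set.indicator_of_notMem]
    · simp
    · exact fun hm => charInfty_notMem (Set.image_subset_range _ _ hm)
  calc μ = μ'.comap charExt := (hc μ _).symm
    _ = ν'.comap charExt := congrArg _ e
    _ = ν := hc ν _
end

section

variable {C : Type*} [NonUnitalCommCStarAlgebra C]

theorem real_sum_integral_eq_zero [TopologicalSpace.SeparableSpace C] {ι : Type*} [Fintype ι]
    (r : ι → ℝ) (μ : ι → FiniteMeasure (characterSpace ℂ C))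
    (h : ∀ a : C, ∑ i, (r i : ℂ) * ∫ χ, χ a ∂(μ i : Measure (characterSpace ℂ C)) = 0)
    (f : characterSpace ℂ C → ℂ) (hf : Measurable f) (M : ℝ) (hM : ∀ χ, ‖f χ‖ ≤ M) :
    ∑ i, (r i : ℂ) * ∫ χ, f χ ∂(μ i : Measure (characterSpace ℂ C)) = 0 := by
  let m (s : ι → ℝ) : Measure (characterSpace ℂ C) :=
    ∑ i, (Real.toNNReal (s i)) • (μ i : Measure (characterSpace ℂ C))
  have hm (s : ι → ℝ) : IsFiniteMeasure (m s) := by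
    refine ⟨?_⟩
    simp only [m, Measure.finsetSum_apply]
    exact ENNReal.sum_lt_top.2 fun i _ => measure_lt_top _ _
  have hint (s : ι → ℝ) (g : characterSpace ℂ C → ℂ)
      (hg : ∀ i, Integrable g (μ i : Measure (characterSpace ℂ C))) :
      ∫ χ, g χ ∂(m s) = ∑ i, ((max (s i) 0 : ℝ) : ℂ) *
        ∫ χ, g χ ∂(μ i : Measure (characterSpace ℂ C)) := by
    rw [integral_finsetSum_measure fun i _ => (hg i).smul_measure_nnreal]
    refine Finset.sum_congr rfl fun i _ => ?_
    rw [integral_smul_nnreal_measure, NNReal.smul_def, Complex.real_smul, Real.coe_toNNReal']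
  have hdiff (g : characterSpace ℂ C → ℂ)
      (hg : ∀ i, Integrable g (μ i : Measure (characterSpace ℂ C))) :
      ∫ χ, g χ ∂(m r) - ∫ χ, g χ ∂(m (-r)) =
        ∑ i, (r i : ℂ) * ∫ χ, g χ ∂(μ i : Measure (characterSpace ℂ C)) := by
    rw [hint _ _ hg, hint _ _ hg, ← Finset.sum_sub_distrib]
    refine Finset.sum_congr rfl fun i _ => ?_
    rw [← sub_mul, ← Complex.ofReal_sub, Pi.neg_apply]
    congr 2
    rcases le_total 0 (r i) with h0 | h0
    · rw [max_eq_left h0, max_eq_right (by linarith), sub_zero]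
    · rw [max_eq_right h0, max_eq_left (by linarith)]; ring
  have e : m r = m (-r) := by
    refine measure_ext_of_char _ _ fun a => sub_eq_zero.1 ?_
    rw [hdiff _ fun i => integrable_char a _, h a]
  rw [← hdiff f fun i => Integrable.of_bound hf.aestronglyMeasurable M (ae_of_all _ hM), e, sub_self]

/-- A complex linear combination of finite Borel measures on the spectrum which annihilates the
Gelfand transforms annihilates all bounded Borel functions. -/
theorem sum_integral_eq_zero [TopologicalSpace.SeparableSpace C] {ι : Type*} [Fintype ι]
    (c : ι → ℂ) (μ : ι → FiniteMeasure (characterSpace ℂ C))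
    (h : ∀ a : C, ∑ i, c i * ∫ χ, χ a ∂(μ i : Measure (characterSpace ℂ C)) = 0)
    (f : characterSpace ℂ C → ℂ) (hf : Measurable f) (M : ℝ) (hM : ∀ χ, ‖f χ‖ ≤ M) :
    ∑ i, c i * ∫ χ, f χ ∂(μ i : Measure (characterSpace ℂ C)) = 0 := by
  have hconj (a : C) :
      ∑ i, conj (c i) * ∫ χ, χ a ∂(μ i : Measure (characterSpace ℂ C)) = 0 := by
    have := congrArg conj (h (star a))
    simpa [map_sum, char_star, integral_conj] using this
  have hre := real_sum_integral_eq_zero (fun i => (c i).re) μ (fun a => by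
    have h2 : ∀ i, ((c i).re : ℂ) = (c i + conj (c i)) / 2 := fun i => by
      rw [Complex.add_conj]; simp
    have := congrArg (fun z : ℂ => z / 2) (congrArg₂ (· + ·) (h a) (hconj a))
    simp only [← Finset.sum_add_distrib, ← add_mul, Finset.sum_div] at this
    simp only [h2]
    rw [add_zero, zero_div] at this
    rw [← this]
    exact Finset.sum_congr rfl fun i _ => by ring) f hf M hM
  have him := real_sum_integral_eq_zero (fun i => (c i).im) μ (fun a => by
    have h2 : ∀ i, ((c i).im : ℂ) = (c i - conj (c i)) / (2 * Complex.I) := fun i => by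
      rw [Complex.sub_conj]; field_simp; push_cast; ring
    have := congrArg (fun z : ℂ => z / (2 * Complex.I)) (congrArg₂ (· - ·) (h a) (hconj a))
    simp only [← Finset.sum_sub_distrib, ← sub_mul, Finset.sum_div] at this
    simp only [h2]
    rw [sub_zero, zero_div] at this
    rw [← this]
    exact Finset.sum_congr rfl fun i _ => by ring) f hf M hM
  have : ∀ i, c i * ∫ χ, f χ ∂(μ i : Measure (characterSpace ℂ C)) =
      ((c i).re : ℂ) * ∫ χ, f χ ∂(μ i : Measure (characterSpace ℂ C)) +
      Complex.I * (((c i).im : ℂ) * ∫ χ, f χ ∂(μ i : Measure (characterSpace ℂ C))) := fun i => by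
    conv_lhs => rw [← Complex.re_add_im (c i)]
    ring
  simp only [this, Finset.sum_add_distrib, ← Finset.mul_sum, hre, him, mul_zero, add_zero]

/-- The complex measure `μ 0 + i μ 1 - μ 2 - i μ 3` represents the functional `ψ`. -/
def Represents (μ : Fin 4 → FiniteMeasure (characterSpace ℂ C)) (ψ : StrongDual ℂ C) : Prop :=
  ∀ a : C, ψ a =
    ∑ k : Fin 4, Complex.I ^ (k : ℕ) * ∫ χ, χ a ∂(μ k : Measure (characterSpace ℂ C))

theorem exists_represents (ψ : StrongDual ℂ C) :
    ∃ μ : Fin 4 → FiniteMeasure (characterSpace ℂ C), Represents μ ψ ∧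
      ∀ k, (μ k : Measure (characterSpace ℂ C)).real Set.univ ≤ ‖ψ‖ := by
  let K := characterSpace ℂ (Unitization ℂ C)
  let inr : C →ₗᵢ[ℂ] Unitization ℂ C := ⟨Unitization.inrHom ℂ ℂ C, Unitization.norm_inr⟩
  obtain ⟨Ψ, hΨ, hΨn⟩ := exists_extension_norm_eq (LinearMap.range inr.toLinearMap)
    (ψ.comp (inr.equivRange.symm.toContinuousLinearEquiv : _ →L[ℂ] C))
  have hΨ' (a : C) : Ψ (a : Unitization ℂ C) = ψ a := by
    have := hΨ (inr.equivRange a)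
    rw [ContinuousLinearMap.comp_apply] at this
    exact this.trans (congrArg ψ (inr.equivRange.symm_apply_apply a))
  have hΨ'n : ‖Ψ‖ ≤ ‖ψ‖ := by
    rw [hΨn]
    refine ContinuousLinearMap.opNorm_le_bound _ (norm_nonneg _) fun x => ?_
    refine (ψ.le_opNorm _).trans_eq ?_
    congr 1
    exact inr.equivRange.symm.norm_map x
  let G := gelfandStarTransform (Unitization ℂ C)
  have hG (g : C(K, ℂ)) : ‖G.symm g‖ = ‖g‖ := by
    have := (gelfandTransform_isometry (Unitization ℂ C)).norm_map_of_map_zero (map_zero _) (G.symm g)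
    rw [← this]
    exact congrArg norm (G.apply_symm_apply g)
  let cpx : C(K, ℝ) →ₗ[ℝ] C(K, ℂ) :=
  { toFun h := ⟨fun κ => (h κ : ℂ), by fun_prop⟩
    map_add' _ _ := by ext; simp
    map_smul' _ _ := by ext; simp }
  have hcpx (h : C(K, ℝ)) : ‖cpx h‖ ≤ ‖h‖ :=
    (ContinuousMap.norm_le _ (norm_nonneg _)).2 fun κ => by
      simpa [cpx] using h.norm_coe_le_norm κ
  let T : C(K, ℝ) →ₗ[ℝ] ℂ :=
  { toFun h := Ψ (G.symm (cpx h))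
    map_add' _ _ := by simp
    map_smul' r h := by
      have : cpx (r • h) = (r : ℂ) • cpx h := by ext; simp [cpx]
      rw [this, map_smul, map_smul]; simp }
  have hT (h : C(K, ℝ)) : ‖T h‖ ≤ ‖ψ‖ * ‖h‖ := by
    calc ‖T h‖ ≤ ‖Ψ‖ * ‖G.symm (cpx h)‖ := Ψ.le_opNorm _
      _ ≤ ‖ψ‖ * ‖h‖ := by rw [hG]; gcongr; exact hcpx h
  obtain ⟨ν₀, ν₂, f₀, f₂, m₀, m₂, h02⟩ := exists_measures_of_bounded (Complex.reLm ∘ₗ T) ‖ψ‖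
    (norm_nonneg _) fun h => (Complex.re_le_norm _).trans (hT h)
  obtain ⟨ν₁, ν₃, f₁, f₃, m₁, m₃, h13⟩ := exists_measures_of_bounded (Complex.imLm ∘ₗ T) ‖ψ‖
    (norm_nonneg _) fun h => ((le_abs_self _).trans (Complex.abs_im_le_norm _)).trans (hT h)
  have hj := measurableEmbedding_charExt (C := C)
  let ν : Fin 4 → Measure K := ![ν₀, ν₁, ν₂, ν₃]
  have hν (k : Fin 4) : IsFiniteMeasure (ν k) := by fin_cases k <;> assumption
  have hνm (k : Fin 4) : (ν k).real Set.univ ≤ ‖ψ‖ := by fin_cases k <;> assumption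
  have hle (k : Fin 4) : ((ν k).comap charExt) Set.univ ≤ (ν k) Set.univ := by
    rw [hj.comap_apply]; exact measure_mono (Set.subset_univ _)
  have hfin (k : Fin 4) : IsFiniteMeasure ((ν k).comap (charExt (C := C))) :=
    ⟨(hle k).trans_lt (measure_lt_top _ _)⟩
  refine ⟨fun k => ⟨(ν k).comap charExt, hfin k⟩, fun a => ?_, fun k => ?_⟩
  · have hcomap (k : Fin 4) : ∫ χ, χ a ∂((ν k).comap (charExt (C := C))) =
        ∫ κ, κ (a : Unitization ℂ C) ∂(ν k) := by
      have h1 : ∫ χ, χ a ∂((ν k).comap (charExt (C := C))) =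
          ∫ χ, charExt χ (a : Unitization ℂ C) ∂((ν k).comap (charExt (C := C))) := by
        simp only [charExt_inr]
      rw [h1, ← hj.integral_map (fun κ : K => κ (a : Unitization ℂ C)), hj.map_comap]
      refine setIntegral_eq_integral_of_forall_compl_eq_zero fun κ hκ => ?_
      rw [← charRes_apply]
      have : charRes κ = 0 := by
        by_contra h0
        exact hκ (mem_range_charExt h0)
      rw [this]; rfl
    simp only [FiniteMeasure.toMeasure_mk, hcomap]
    let g : C(K, ℂ) := G (a : Unitization ℂ C)
    let u : C(K, ℝ) := ⟨fun κ => (g κ).re, by fun_prop⟩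
    let v : C(K, ℝ) := ⟨fun κ => (g κ).im, by fun_prop⟩
    have hg : g = cpx u + Complex.I • cpx v := by
      ext κ
      simp only [cpx, u, v, ContinuousMap.add_apply, ContinuousMap.smul_apply, smul_eq_mul]
      exact (Complex.re_add_im (g κ)).symm.trans (by rw [mul_comm]; rfl)
    have hψ : ψ a = T u + Complex.I * T v := by
      rw [← hΨ', ← G.symm_apply_apply (a : Unitization ℂ C)]
      change Ψ (G.symm g) = _
      rw [hg, map_add, map_smul, map_add, map_smul]
      rfl
    have hTe (h : C(K, ℝ)) : T h = ((∫ κ, h κ ∂ν₀ - ∫ κ, h κ ∂ν₂ : ℝ) : ℂ) +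
        ((∫ κ, h κ ∂ν₁ - ∫ κ, h κ ∂ν₃ : ℝ) : ℂ) * Complex.I := by
      rw [← h02, ← h13]
      exact (Complex.re_add_im (T h)).symm
    have hint (k : Fin 4) : ∫ κ, κ (a : Unitization ℂ C) ∂(ν k) =
        ((∫ κ, u κ ∂(ν k) : ℝ) : ℂ) + Complex.I * ((∫ κ, v κ ∂(ν k) : ℝ) : ℂ) := by
      have hi (h : C(K, ℝ)) : Integrable (fun κ => ((h κ : ℝ) : ℂ)) (ν k) :=
        (h.continuous.integrable_of_hasCompactSupport
          (HasCompactSupport.of_compactSpace _)).ofReal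
      rw [← integral_complex_ofReal, ← integral_complex_ofReal, ← integral_const_mul,
        ← integral_add (hi u) ((hi v).const_mul _)]
      refine integral_congr_ae (ae_of_all _ fun κ => ?_)
      exact DFunLike.congr_fun hg κ
    simp only [hint, hψ, hTe, Fin.sum_univ_four, ν]
    simp [pow_succ]
    ring_nf
  · refine le_trans ?_ (hνm k)
    exact ENNReal.toReal_mono (measure_ne_top _ _) (hle k)

end

/-! ### The C⋆-algebra of bounded Borel functions -/

/-- The bounded complex-valued Borel functions on `X`, as a ⋆-subalgebra of `ℓ^∞(X)`. -/
def boundedBorel (X : Type*) [MeasurableSpace X] : StarSubalgebra ℂ (lp (fun _ : X => ℂ) ∞) where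
  carrier := {f | Measurable (f : X → ℂ)}
  mul_mem' hf hg := by
    simp only [Set.mem_ofPred_eq, lp.infty_coeFn_mul] at *
    exact hf.mul hg
  one_mem' := measurable_const
  add_mem' hf hg := by
    simp only [Set.mem_ofPred_eq, lp.coeFn_add] at *
    exact hf.add hg
  zero_mem' := measurable_const
  algebraMap_mem' c := by
    rw [Set.mem_ofPred_eq, Algebra.algebraMap_eq_smul_one, lp.coeFn_smul, lp.infty_coeFn_one]
    exact measurable_const (a := c • (1 : ℂ))
  star_mem' hf := by
    simp only [Set.mem_ofPred_eq, lp.coeFn_star] at *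
    exact Complex.continuous_conj.measurable.comp hf

instance boundedBorel.instIsClosed (X : Type*) [MeasurableSpace X] :
    IsClosed (boundedBorel X : Set (lp (fun _ : X => ℂ) ∞)) := by
  refine IsSeqClosed.isClosed fun u f hu hf => ?_
  refine measurable_of_tendsto_metrizable (f := fun n => (u n : X → ℂ)) hu ?_
  rw [tendsto_pi_nhds]
  exact fun x => ((lp.lipschitzWith_one_eval (E := fun _ : X => ℂ) ∞ x).continuous.tendsto f).comp hf

/-- `B(X)`, the C⋆-algebra of bounded Borel functions on `X` with pointwise operations and the
supremum norm. -/
def BoundedBorel (X : Type*) [MeasurableSpace X] : Type _ := boundedBorel X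

namespace BoundedBorel

variable {X : Type*} [MeasurableSpace X]

instance : CommCStarAlgebra (BoundedBorel X) :=
  inferInstanceAs (CommCStarAlgebra (boundedBorel X))

instance : CoeFun (BoundedBorel X) fun _ => X → ℂ := ⟨fun f => (f.1 : X → ℂ)⟩

theorem measurable (f : BoundedBorel X) : Measurable (f : X → ℂ) := f.2

theorem norm_apply_le (f : BoundedBorel X) (x : X) : ‖f x‖ ≤ ‖f‖ :=
  lp.norm_apply_le_norm ENNReal.top_ne_zero f.1 x

theorem add_apply (f g : BoundedBorel X) (x : X) : (f + g) x = f x + g x := rfl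

theorem smul_apply (c : ℂ) (f : BoundedBorel X) (x : X) : (c • f) x = c * f x := rfl

open scoped ComplexOrder

/-- The pointwise order. -/
instance : PartialOrder (BoundedBorel X) :=
  PartialOrder.lift (fun f : BoundedBorel X => (f : X → ℂ))
    fun _ _ h => Subtype.ext (lp.ext h)

theorem le_def (f g : BoundedBorel X) : f ≤ g ↔ ∀ x, f x ≤ g x := Iff.rfl

instance : StarOrderedRing (BoundedBorel X) := by
  refine StarOrderedRing.of_nonneg_iff' (R := BoundedBorel X) (fun {f g} h k x => ?_) fun f => ⟨fun h => ?_, ?_⟩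
  · exact add_le_add_right (h x) (k x)
  · have hr (x : X) : ((f x).re : ℂ) = f x := by
      have := h x
      exact Complex.ext rfl (Complex.le_def.1 this).2
    have hn (x : X) : 0 ≤ (f x).re := (Complex.le_def.1 (h x)).1
    let s : X → ℂ := fun x => (Real.sqrt (f x).re : ℂ)
    have hs : Memℓp s ∞ := memℓp_infty ⟨Real.sqrt ‖f‖, by
      rintro _ ⟨x, rfl⟩
      simp only [s, Complex.norm_real, Real.norm_eq_abs, abs_of_nonneg (Real.sqrt_nonneg _)]
      exact Real.sqrt_le_sqrt ((Complex.re_le_norm _).trans (f.norm_apply_le x))⟩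
    have hsm : Measurable s :=
      Complex.measurable_ofReal.comp (Complex.measurable_re.comp f.measurable).sqrt
    refine ⟨⟨⟨s, hs⟩, hsm⟩, Subtype.ext (lp.ext (funext fun x => ?_))⟩
    change f x = star (s x) * s x
    simp only [s, Complex.star_def, Complex.conj_ofReal, ← Complex.ofReal_mul,
      Real.mul_self_sqrt (hn x), hr]
  · rintro ⟨s, rfl⟩ x
    exact star_mul_self_nonneg (s x)

end BoundedBorel

/-! ### Biduals -/

/-- The bidual `E**` of a complex normed space. -/
abbrev Bidual (E : Type*) [SeminormedAddCommGroup E] [NormedSpace ℂ E] : Type _ :=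
  StrongDual ℂ (StrongDual ℂ E)

/-- The second adjoint `φ** : E** → F**`. -/
def ContinuousLinearMap.bidual {E F : Type*} [SeminormedAddCommGroup E] [NormedSpace ℂ E]
    [SeminormedAddCommGroup F] [NormedSpace ℂ F] (φ : E →L[ℂ] F) : Bidual E →L[ℂ] Bidual F :=
  (φ.precomp ℂ).precomp ℂ

section Arens

variable {B : Type*} [NonUnitalCStarAlgebra B]

/-- The functional `y · ψ : b ↦ y (c ↦ ψ (b c))` on `B`, for `y ∈ B**` and `ψ ∈ B*`. -/
def arensAct (y : Bidual B) : StrongDual ℂ B →L[ℂ] StrongDual ℂ B :=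
  (ContinuousLinearMap.compL ℂ B (StrongDual ℂ B) ℂ y).comp
    (((ContinuousLinearMap.compL ℂ B (B →L[ℂ] B) (StrongDual ℂ B)).flip
      (ContinuousLinearMap.mul ℂ B)).comp (ContinuousLinearMap.compL ℂ B B ℂ))

/-- The product of the C⋆-algebra `B**`, given by the Arens product
`(x y)(ψ) = x (b ↦ y (c ↦ ψ (b c)))`. -/
instance Bidual.instMul : Mul (Bidual B) := ⟨fun x y => x.comp (arensAct y)⟩

theorem arensAct_apply (y : Bidual B) (ψ : StrongDual ℂ B) (b : B) :
    arensAct y ψ b = y (ψ.comp (ContinuousLinearMap.mul ℂ B b)) := rfl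

theorem Bidual.mul_apply (x y : Bidual B) (ψ : StrongDual ℂ B) :
    (x * y) ψ = x (arensAct y ψ) := rfl

end Arens

/-! ### The bounded Borel functions inside the bidual -/

section

variable {C : Type*} [NonUnitalCommCStarAlgebra C]

/-- The integral of a bounded Borel function on the spectrum of `C` against the complex measure
representing `ψ`. -/
def borelPairing (f : BoundedBorel (characterSpace ℂ C)) (ψ : StrongDual ℂ C) : ℂ :=
  ∑ k : Fin 4, Complex.I ^ (k : ℕ) *
    ∫ χ, f χ ∂((exists_represents ψ).choose k : Measure (characterSpace ℂ C))

theorem integrable_borel (f : BoundedBorel (characterSpace ℂ C))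
    (μ : Measure (characterSpace ℂ C)) [IsFiniteMeasure μ] : Integrable (fun χ => f χ) μ :=
  Integrable.of_bound f.measurable.aestronglyMeasurable ‖f‖ (ae_of_all _ f.norm_apply_le)

theorem norm_borelPairing_le (f : BoundedBorel (characterSpace ℂ C)) (ψ : StrongDual ℂ C) :
    ‖borelPairing f ψ‖ ≤ 4 * ‖f‖ * ‖ψ‖ := by
  obtain ⟨-, hm⟩ := (exists_represents ψ).choose_spec
  have key (k : Fin 4) : ‖Complex.I ^ (k : ℕ) *
      ∫ χ, f χ ∂((exists_represents ψ).choose k : Measure (characterSpace ℂ C))‖ ≤ ‖f‖ * ‖ψ‖ := by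
    rw [norm_mul, norm_pow, Complex.norm_I, one_pow, one_mul]
    refine (norm_integral_le_of_norm_le_const (ae_of_all _ f.norm_apply_le)).trans ?_
    gcongr
    exact hm k
  refine (norm_sum_le_of_le _ fun k _ => key k).trans_eq ?_
  simp; ring

theorem sum_borelPairing_eq_zero [TopologicalSpace.SeparableSpace C] {ι : Type*} [Fintype ι]
    (f : BoundedBorel (characterSpace ℂ C)) (c : ι → ℂ) (ψ : ι → StrongDual ℂ C)
    (h : ∑ i, c i • ψ i = 0) : ∑ i, c i * borelPairing f (ψ i) = 0 := by
  have := sum_integral_eq_zero (fun p : ι × Fin 4 => c p.1 * Complex.I ^ (p.2 : ℕ))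
    (fun p => (exists_represents (ψ p.1)).choose p.2) (fun a => ?_) f f.measurable ‖f‖
    f.norm_apply_le
  · rw [Fintype.sum_prod_type] at this
    simpa only [borelPairing, Finset.mul_sum, mul_assoc] using this
  · rw [Fintype.sum_prod_type]
    simp only [mul_assoc, ← Finset.mul_sum]
    have h' := DFunLike.congr_fun h a
    simp only [sum_apply, smul_apply, smul_eq_mul] at h'
    refine Eq.trans (Finset.sum_congr rfl fun i _ => ?_) h'
    rw [← (exists_represents (ψ i)).choose_spec.1 a]

theorem borelPairing_add_left (f g : BoundedBorel (characterSpace ℂ C)) (ψ : StrongDual ℂ C) :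
    borelPairing (f + g) ψ = borelPairing f ψ + borelPairing g ψ := by
  simp only [borelPairing, BoundedBorel.add_apply, ← Finset.sum_add_distrib, ← mul_add]
  refine Finset.sum_congr rfl fun k _ => ?_
  rw [← integral_add (integrable_borel f _) (integrable_borel g _)]

theorem borelPairing_smul_left (c : ℂ) (f : BoundedBorel (characterSpace ℂ C))
    (ψ : StrongDual ℂ C) : borelPairing (c • f) ψ = c • borelPairing f ψ := by
  simp only [borelPairing, BoundedBorel.smul_apply, smul_eq_mul, Finset.mul_sum]
  refine Finset.sum_congr rfl fun k _ => ?_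
  rw [mul_left_comm, ← integral_const_mul c]

theorem borelPairing_add_right [TopologicalSpace.SeparableSpace C]
    (f : BoundedBorel (characterSpace ℂ C)) (ψ ψ' : StrongDual ℂ C) :
    borelPairing f (ψ + ψ') = borelPairing f ψ + borelPairing f ψ' := by
  have := sum_borelPairing_eq_zero f ![1, -1, -1] ![ψ + ψ', ψ, ψ']
    (by
      ext a
      simp only [Fin.sum_univ_three, add_apply, smul_apply, smul_eq_mul, Matrix.cons_val,
        zero_apply]
      ring)
  simp [Fin.sum_univ_three] at this
  linear_combination this

theorem borelPairing_smul_right [TopologicalSpace.SeparableSpace C] (c : ℂ)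
    (f : BoundedBorel (characterSpace ℂ C)) (ψ : StrongDual ℂ C) :
    borelPairing f (c • ψ) = c • borelPairing f ψ := by
  have := sum_borelPairing_eq_zero f ![1, -c] ![c • ψ, ψ]
    (by
      ext a
      simp only [Fin.sum_univ_two, add_apply, smul_apply, smul_eq_mul, Matrix.cons_val, zero_apply]
      ring)
  simp at this
  rw [smul_eq_mul]
  linear_combination this

/-- The canonical map `B(σ(C)) → C**`: a bounded Borel function `f` is sent to the functional
`ψ ↦ ∫ f dμ_ψ` on `C*`, where `μ_ψ` is the complex Borel measure on `σ(C)` which represents `ψ`. -/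
def borelBidual (C : Type*) [NonUnitalCommCStarAlgebra C] [TopologicalSpace.SeparableSpace C] :
    BoundedBorel (characterSpace ℂ C) →L[ℂ] Bidual C :=
  LinearMap.mkContinuous₂
    (LinearMap.mk₂ ℂ borelPairing borelPairing_add_left borelPairing_smul_left
      borelPairing_add_right fun c f ψ => borelPairing_smul_right c f ψ)
    4 norm_borelPairing_le

/-- The value of `borelBidual C f` at `ψ` is computed with any measure representing `ψ`. -/
theorem borelBidual_apply [TopologicalSpace.SeparableSpace C]
    (f : BoundedBorel (characterSpace ℂ C)) (ψ : StrongDual ℂ C)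
    (μ : Fin 4 → FiniteMeasure (characterSpace ℂ C)) (h : Represents μ ψ) :
    borelBidual C f ψ = ∑ k : Fin 4, Complex.I ^ (k : ℕ) *
      ∫ χ, f χ ∂(μ k : Measure (characterSpace ℂ C)) := by
  have := sum_integral_eq_zero
    (Sum.elim (fun k : Fin 4 => Complex.I ^ (k : ℕ)) (fun k : Fin 4 => -Complex.I ^ (k : ℕ)))
    (Sum.elim (exists_represents ψ).choose μ) (fun a => ?_) f f.measurable ‖f‖ f.norm_apply_le
  · simp only [Fintype.sum_sum_type, Sum.elim_inl, Sum.elim_inr, neg_mul,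
      Finset.sum_neg_distrib] at this
    exact sub_eq_zero.1 ((sub_eq_add_neg _ _).trans this)
  · simp only [Fintype.sum_sum_type, Sum.elim_inl, Sum.elim_inr, neg_mul, Finset.sum_neg_distrib]
    rw [← (exists_represents ψ).choose_spec.1 a, ← h a, add_neg_cancel]

end

section

variable {A : Type*} [NonUnitalCStarAlgebra A] (A₀ : NonUnitalStarSubalgebra ℂ A)
  [IsClosed (A₀ : Set A)] [IsMulCommutative A₀]

/-- A norm-closed commutative ⋆-subalgebra of a C⋆-algebra is a commutative C⋆-algebra. -/
instance NonUnitalStarSubalgebra.instNonUnitalCommCStarAlgebra : NonUnitalCommCStarAlgebra A₀ where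
  __ := (inferInstance : NonUnitalCStarAlgebra A₀)
  mul_comm := IsMulCommutative.is_comm.comm

/-- The inclusion `B(σ(A₀)) ⊆ A**`, the composition of `B(σ(A₀)) ⊆ A₀**` with the second adjoint
of the inclusion `A₀ ⊆ A`. -/
def borelInclusion [TopologicalSpace.SeparableSpace A₀] :
    BoundedBorel (characterSpace ℂ A₀) →L[ℂ] Bidual A :=
  (ContinuousLinearMap.bidual (⟨A₀.subtype, continuous_subtype_val⟩ : A₀ →L[ℂ] A)).comp
    (borelBidual A₀)

end

/-! ### Approximately order zero maps -/

/-- Orthogonality `x ⊥ y` in a C⋆-algebra. -/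
def Orthogonal {A : Type*} [NonUnitalCStarAlgebra A] (x y : A) : Prop :=
  x * y = 0 ∧ y * x = 0 ∧ star x * y = 0 ∧ x * star y = 0

/-- A bounded linear map `φ` is `ε`-order zero if `‖φ x φ y‖ ≤ ε ‖x‖ ‖y‖` for all positive
`x ⊥ y`. -/
def IsEpsOrderZero {A E : Type*} [NonUnitalCStarAlgebra A] [PartialOrder A] [StarOrderedRing A]
    [NormedAddCommGroup E] [NormedSpace ℂ E] [Mul E] (ε : ℝ) (φ : A →L[ℂ] E) : Prop :=
  ∀ x y : A, 0 ≤ x → 0 ≤ y → Orthogonal x y → ‖φ x * φ y‖ ≤ ε * ‖x‖ * ‖y‖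

end

/-! Evaluated at `ξ`, the Arens product of `φ**(f)` and `φ**(g)` is an iterated pairing. It is the
pairing of `f` with the functional `Ψ` on `A₀` whose value at `a` is the pairing of `g` with `c ↦ ξ
(φ a * φ c)`. Approximate `f` in `L¹` by a positive `a`, and then `g` by a positive `c` with respect
to the measure of the functional belonging to `a`. If `a ⊥ c`, the hypothesis on `φ` bounds `ξ (φ a
* φ c)`.

The obstacle is the order of choices. The supports of `f` and `g` are disjoint but need not have
disjoint neighbourhoods, so both functions must first be cut down to compact sets `P` and `L`.
Disjoint neighbourhoods of these then carry `a` and `c`. Thus `L` has to be fixed before `a` is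
known, although the functional against which `g` is tested depends on `a`. What is needed is one
compact set `L` that works for all functionals `c ↦ ξ (b * φ c)` with `b` in a ball; this is
`exists_isCompact_forall_norm_sub_le`.

That uniformity comes from an `ℓ²` estimate. If no such `L` exists, exhaustion gives infinitely many
disjoint compact sets and bounded `b i`, hence for every `N` disjointly supported `c i` with `‖ξ (b
i * φ (c i))‖` bounded below for all `i` among `N`. Disjointness bounds all signed sums of the `c
i`, hence those of the `φ (c i)`. Averaging over signs bounds the column `(φ (c i))` independently
of `N`, while the row `(b i)` has norm of order `√N`. Cauchy-Schwarz then makes a quantity of order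
`N` at most a constant times `√N`, which is absurd for large `N`
(`card_mul_le_of_norm_sum_zsmul_le`). -/

noncomputable section

open MeasureTheory WeakDual ComplexConjugate
open scoped ENNReal

/-! ### Row and column estimates in a C⋆-algebra -/

section RowColumn

variable {B : Type*} [NonUnitalCStarAlgebra B]

/-- Averaging over signs: if all sums `y + ∑ ± c i` have norm at most `M`, then the column with
entries `y` and `c i` has norm at most `M`. -/
theorem norm_star_mul_self_add_sum_le {ι : Type*} (s : Finset ι) (c : ι → B) {M : ℝ} (y : B)
    (h : ∀ e : ι → ℤˣ, ‖y + ∑ i ∈ s, (e i : ℤ) • c i‖ ≤ M) :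
    ‖star y * y + ∑ i ∈ s, star (c i) * c i‖ ≤ M ^ 2 := by
  classical
  induction s using Finset.induction_on generalizing y with
  | empty =>
    have := h 1
    simp only [Finset.sum_empty, add_zero] at this ⊢
    rw [CStarRing.norm_star_mul_self, sq]
    exact mul_self_le_mul_self (norm_nonneg _) this
  | insert j s hj ih =>
    -- The sign of the new entry is absorbed into `y`, which is why the induction generalizes `y`:
    -- the hypothesis is applied to `y + c j` and to `y - c j`.
    have key (u : ℤˣ) (e : ι → ℤˣ) : ‖(y + (u : ℤ) • c j) + ∑ i ∈ s, (e i : ℤ) • c i‖ ≤ M := by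
      refine le_of_eq_of_le ?_ (h (Function.update e j u))
      rw [Finset.sum_insert hj, Function.update_self, add_assoc]
      congr 3
      refine Finset.sum_congr rfl fun i hi => ?_
      rw [Function.update_of_ne (ne_of_mem_of_not_mem hi hj)]
    have h1 := ih _ (key 1)
    have h2 := ih _ (key (-1))
    rw [Finset.sum_insert hj]
    -- Parallelogram identity: the cross terms cancel in the average of the two signs.
    have e : star y * y + (star (c j) * c j + ∑ i ∈ s, star (c i) * c i) = (2⁻¹ : ℂ) •
        ((star (y + ((1 : ℤˣ) : ℤ) • c j) * (y + ((1 : ℤˣ) : ℤ) • c j) +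
            ∑ i ∈ s, star (c i) * c i) +
          (star (y + ((-1 : ℤˣ) : ℤ) • c j) * (y + ((-1 : ℤˣ) : ℤ) • c j) +
            ∑ i ∈ s, star (c i) * c i)) := by
      rw [eq_inv_smul_iff₀ two_ne_zero, two_smul]
      simp only [Units.val_one, Units.val_neg, one_smul, neg_smul, star_add, star_neg, mul_add,
        add_mul, neg_mul, mul_neg]
      abel
    rw [e, norm_smul]
    refine (mul_le_mul_of_nonneg_left (norm_add_le_of_le h1 h2) (norm_nonneg _)).trans_eq ?_
    rw [norm_inv, Complex.norm_ofNat]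
    ring

/-- The Cauchy-Schwarz inequality for a row and a column over a C⋆-algebra. -/
theorem norm_sum_mul_le {ι : Type*} [Fintype ι] (b c : ι → B) :
    ‖∑ i, b i * c i‖ ≤ √‖∑ i, b i * star (b i)‖ * √‖∑ i, star (c i) * c i‖ := by
  let _ : PartialOrder B := CStarAlgebra.spectralOrder B
  have _ : StarOrderedRing B := CStarAlgebra.spectralOrderedRing B
  -- The inner product of rows is `∑ y i * star (x i)`, so the column `c` enters through the row of
  -- its adjoints.
  let x : WithCStarModule B (ι → B) := (WithCStarModule.equiv B (ι → B)).symm fun i => star (c i)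
  let y : WithCStarModule B (ι → B) := (WithCStarModule.equiv B (ι → B)).symm b
  have h := CStarModule.norm_inner_le (A := B) (WithCStarModule B (ι → B)) (x := x) (y := y)
  rw [WithCStarModule.pi_inner, WithCStarModule.pi_norm, WithCStarModule.pi_norm] at h
  simp only [WithCStarModule.inner_def, x, y, WithCStarModule.equiv_symm_pi_apply, star_star] at h
  rwa [mul_comm]

/-- Elements `c i` all of whose signed sums are bounded pair in an `ℓ²` way with bounded elements
`b i`. -/
theorem card_mul_le_of_norm_sum_zsmul_le {ι : Type*} [Fintype ι] (ξ : StrongDual ℂ B)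
    (b c : ι → B) {R M δ : ℝ} (hM : 0 ≤ M) (hb : ∀ i, ‖b i‖ ≤ R)
    (hc : ∀ e : ι → ℤˣ, ‖∑ i, (e i : ℤ) • c i‖ ≤ M) (hδ : ∀ i, δ ≤ ‖ξ (b i * c i)‖) :
    Fintype.card ι * δ ≤ ‖ξ‖ * (√(Fintype.card ι * R ^ 2) * M) := by
  -- The phases `u i` make all the terms nonnegative, so that nothing cancels in the sum;
  -- multiplying `b i` by a phase leaves `b i * star (b i)` unchanged.
  have hu (i : ι) : ∃ u : ℂ, ‖u‖ = 1 ∧ u * ξ (b i * c i) = ‖ξ (b i * c i)‖ := by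
    obtain ⟨u, hu, hu'⟩ := RCLike.exists_norm_eq_mul_self (ξ (b i * c i))
    exact ⟨u, hu, hu'.symm⟩
  choose u hu hu' using hu
  have h1 : (Fintype.card ι * δ : ℝ) ≤ ‖ξ (∑ i, (u i • b i) * c i)‖ := by
    have : ξ (∑ i, (u i • b i) * c i) = ((∑ i, ‖ξ (b i * c i)‖ : ℝ) : ℂ) := by
      simp only [map_sum, smul_mul_assoc, map_smul, smul_eq_mul, hu', Complex.ofReal_sum]
    rw [this, Complex.norm_real, Real.norm_eq_abs]
    refine le_trans ?_ (le_abs_self _)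
    simpa using Finset.card_nsmul_le_sum Finset.univ _ δ fun i _ => hδ i
  refine h1.trans ((ξ.le_opNorm _).trans ?_)
  refine mul_le_mul_of_nonneg_left ((norm_sum_mul_le _ _).trans ?_) (norm_nonneg _)
  refine mul_le_mul (Real.sqrt_le_sqrt ?_) ?_ (Real.sqrt_nonneg _) (Real.sqrt_nonneg _)
  · refine (norm_sum_le_of_le _ (n := fun _ => R ^ 2) fun i _ => ?_).trans_eq (by simp)
    rw [CStarRing.norm_self_mul_star, norm_smul, hu, one_mul, sq]
    exact mul_self_le_mul_self (norm_nonneg _) (hb i)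
  · rw [Real.sqrt_le_left hM]
    simpa using norm_star_mul_self_add_sum_le (M := M) Finset.univ c 0 fun e => by
      rw [zero_add]; exact hc e

end RowColumn

/-! ### The topology of the spectrum -/

section Spectrum

variable {C : Type*} [NonUnitalCommCStarAlgebra C]

/-- Restriction to `C` recovers a character continuously, and the range is the open set of
characters not vanishing on `C`. Hence the spectrum inherits local compactness, the Hausdorff
property and, for separable `C`, second countability from the compact spectrum of the unitization.
These properties supply the regularity of finite Borel measures used for the `L¹` approximations. -/
theorem isOpenEmbedding_charExt : Topology.IsOpenEmbedding
    (charExt : characterSpace ℂ C → characterSpace ℂ (Unitization ℂ C)) := by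
  have h1 : Topology.IsEmbedding
      (charRes ∘ (charExt : characterSpace ℂ C → characterSpace ℂ (Unitization ℂ C))) := by
    have : charRes ∘ (charExt : characterSpace ℂ C → characterSpace ℂ (Unitization ℂ C)) =
      Subtype.val := funext charRes_charExt
    rw [this]; exact Topology.IsEmbedding.subtypeVal
  refine ⟨Topology.IsEmbedding.of_comp continuous_charExt continuous_charRes h1, ?_⟩
  rw [range_charExt]
  exact isOpen_compl_singleton.preimage continuous_charRes

instance characterSpace.instLocallyCompactSpace : LocallyCompactSpace (characterSpace ℂ C) :=
  isOpenEmbedding_charExt.locallyCompactSpace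

instance characterSpace.instT2Space : T2Space (characterSpace ℂ C) :=
  isOpenEmbedding_charExt.isEmbedding.t2Space

instance Unitization.instSeparableSpace [TopologicalSpace.SeparableSpace C] :
    TopologicalSpace.SeparableSpace (Unitization ℂ C) := by
  have hd : DenseRange (fun p : ℂ × C => (Unitization.inl p.1 + (p.2 : Unitization ℂ C))) :=
    Function.Surjective.denseRange fun z => ⟨(z.fst, z.snd), Unitization.inl_fst_add_inr_snd_eq z⟩
  refine hd.separableSpace ?_
  have h1 : Continuous (fun c : ℂ => (Unitization.inl c : Unitization ℂ C)) := by
    simpa [← Unitization.algebraMap_eq_inl] using continuous_algebraMap ℂ (Unitization ℂ C)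
  exact (h1.comp continuous_fst).add (Unitization.continuous_inr.comp continuous_snd)

instance characterSpace.instMetrizableSpaceUnitization [TopologicalSpace.SeparableSpace C] :
    TopologicalSpace.MetrizableSpace (characterSpace ℂ (Unitization ℂ C)) :=
  WeakDual.metrizable_of_isCompact ℂ _ _ (isCompact_iff_compactSpace.2 inferInstance)

instance characterSpace.instMetrizableSpace [TopologicalSpace.SeparableSpace C] :
    TopologicalSpace.MetrizableSpace (characterSpace ℂ C) :=
  isOpenEmbedding_charExt.isEmbedding.metrizableSpace

instance characterSpace.instSecondCountableTopology [TopologicalSpace.SeparableSpace C] :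
    SecondCountableTopology (characterSpace ℂ C) := by
  let _ : MetricSpace (characterSpace ℂ (Unitization ℂ C)) :=
    TopologicalSpace.metrizableSpaceMetric _
  have : SecondCountableTopology (characterSpace ℂ (Unitization ℂ C)) := inferInstance
  exact isOpenEmbedding_charExt.isEmbedding.secondCountableTopology

/-- The norm is the supremum norm of the Gelfand transform. -/
theorem norm_le_of_char {a : C} {M : ℝ} (hM : 0 ≤ M) (h : ∀ χ : characterSpace ℂ C, ‖χ a‖ ≤ M) :
    ‖a‖ ≤ M := by
  rw [← Unitization.norm_inr (𝕜 := ℂ) a, ← (gelfandTransform_isometry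
    (Unitization ℂ C)).norm_map_of_map_zero (map_zero _)]
  refine (ContinuousMap.norm_le _ hM).2 fun κ => ?_
  change ‖κ (a : Unitization ℂ C)‖ ≤ M
  -- A character of the unitization either vanishes on `C` or extends a character of `C`.
  by_cases hκ : charRes κ = 0
  · rw [← charRes_apply, hκ]
    exact norm_zero.trans_le hM
  · obtain ⟨χ, rfl⟩ := mem_range_charExt hκ
    rw [charExt_inr]
    exact h χ

theorem eq_of_char {a b : C} (h : ∀ χ : characterSpace ℂ C, χ a = χ b) : a = b := by
  rw [← sub_eq_zero, ← norm_le_zero_iff]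
  exact norm_le_of_char le_rfl fun χ => by rw [map_sub, h, sub_self, norm_zero]

theorem char_mul (χ : characterSpace ℂ C) (a b : C) : χ (a * b) = χ a * χ b :=
  map_mul χ a b

/-- Continuous functions with compact support on the spectrum are Gelfand transforms. -/
theorem exists_char_eq (h : characterSpace ℂ C → ℂ) (hc : Continuous h)
    (hs : HasCompactSupport h) : ∃ a : C, ∀ χ : characterSpace ℂ C, χ a = h χ := by
  let e := (isOpenEmbedding_charExt (C := C)).isEmbedding.toHomeomorph
  -- Extension of `h` by zero at the point at infinity; compact support makes it continuous.
  let F : characterSpace ℂ (Unitization ℂ C) → ℂ :=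
    Function.extend Subtype.val (h ∘ e.symm) 0
  have hF : Continuous F := (hs.comp_homeomorph e.symm).continuous_extend_zero
    isOpenEmbedding_charExt.isOpen_range (hc.comp e.symm.continuous)
  have hFe (χ : characterSpace ℂ C) : F (charExt χ) = h χ :=
    (Subtype.val_injective.extend_apply (h ∘ e.symm) 0 (e χ)).trans
      (congrArg h (e.symm_apply_apply χ))
  have hF0 : F (charInfty C) = 0 := by
    refine Function.extend_apply' _ _ _ ?_
    rintro ⟨x, hx⟩
    exact charInfty_notMem (hx ▸ x.2)
  obtain ⟨z, hz⟩ := (gelfandTransform_bijective (Unitization ℂ C)).2 ⟨F, hF⟩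
  have hz' (κ : characterSpace ℂ (Unitization ℂ C)) : κ z = F κ := DFunLike.congr_fun hz κ
  refine ⟨z.snd, fun χ => ?_⟩
  -- The scalar part of `z` is its value at infinity, so its vanishing places `z` in `C`.
  have h0 : z.fst = 0 := by rw [← charInfty_apply, hz', hF0]
  rw [← hFe, ← hz', char_apply, h0, zero_add, charExt_inr]

/-- Signed sums of elements with disjoint supports. -/
theorem norm_sum_zsmul_le_of_disjoint {ι : Type*} [Fintype ι] (c : ι → C)
    (V : ι → Set (characterSpace ℂ C)) (hV : Pairwise (Function.onFun Disjoint V)) {M : ℝ}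
    (hM : 0 ≤ M) (hc : ∀ i, ‖c i‖ ≤ M)
    (hcV : ∀ i, ∀ χ ∉ V i, (χ : characterSpace ℂ C) (c i) = 0) (e : ι → ℤˣ) :
    ‖∑ i, (e i : ℤ) • c i‖ ≤ M := by
  refine norm_le_of_char hM fun χ => ?_
  rw [map_sum]
  -- At each character at most one summand is nonzero, and its sign does not affect the modulus.
  by_cases h : ∃ i, χ ∈ V i
  · obtain ⟨i, hi⟩ := h
    rw [Finset.sum_eq_single i (fun j _ hj => ?_) (by simp)]
    · rw [map_zsmul]
      have : ‖(e i : ℤ) • χ (c i)‖ = ‖χ (c i)‖ := by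
        rcases Int.units_eq_one_or (e i) with h | h <;> simp [h]
      rw [this]
      exact (norm_char_apply_le χ _).trans (hc i)
    · rw [map_zsmul, hcV j χ fun hj' => Set.disjoint_left.1 (hV hj) hj' hi, smul_zero]
  · push Not at h
    rw [Finset.sum_eq_zero fun i _ => ?_, norm_zero]
    · exact hM
    · rw [map_zsmul, hcV i χ (h i), smul_zero]

end Spectrum

/-! ### Approximation of bounded Borel functions -/

/-- The bounded Borel function which agrees with `g` on `s` and vanishes off `s`. -/
def BoundedBorel.indicator {X : Type*} [MeasurableSpace X] (g : BoundedBorel X) {s : Set X}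
    (hs : MeasurableSet s) : BoundedBorel X :=
  ⟨⟨s.indicator g, memℓp_infty ⟨‖g‖, by
    rintro _ ⟨x, rfl⟩
    exact (norm_indicator_le_norm_self _ _).trans (g.norm_apply_le x)⟩⟩,
    g.measurable.indicator hs⟩

theorem BoundedBorel.indicator_apply {X : Type*} [MeasurableSpace X] (g : BoundedBorel X)
    {s : Set X} (hs : MeasurableSet s) (x : X) : g.indicator hs x = s.indicator g x := rfl

theorem BoundedBorel.indicator_support {X : Type*} [MeasurableSpace X] (g : BoundedBorel X)
    (hs : MeasurableSet {x | g x ≠ 0}) : g.indicator hs = g :=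
  Subtype.ext (lp.ext (Set.indicator_support (f := (g : X → ℂ))))

theorem BoundedBorel.measurableSet_support {X : Type*} [MeasurableSpace X] (g : BoundedBorel X) :
    MeasurableSet {x | g x ≠ 0} :=
  (g.measurable (measurableSet_singleton 0)).compl

section Approximation

variable {C : Type*} [NonUnitalCommCStarAlgebra C] [TopologicalSpace.SeparableSpace C]

/-- The pairing with `ψ` is controlled by the `L¹`-norm for a finite measure. -/
theorem exists_dominating_measure (ψ : StrongDual ℂ C) :
    ∃ ν : Measure (characterSpace ℂ C), IsFiniteMeasure ν ∧
      (∀ f g : BoundedBorel (characterSpace ℂ C),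
        ‖borelBidual C f ψ - borelBidual C g ψ‖ ≤ ∫ χ, ‖f χ - g χ‖ ∂ν) ∧
      ∀ (f : BoundedBorel (characterSpace ℂ C)) (a : C),
        ‖borelBidual C f ψ - ψ a‖ ≤ ∫ χ, ‖f χ - χ a‖ ∂ν := by
  obtain ⟨μ, hμ, -⟩ := exists_represents ψ
  have key (u v : characterSpace ℂ C → ℂ)
      (hu : ∀ k, Integrable u (μ k : Measure (characterSpace ℂ C)))
      (hv : ∀ k, Integrable v (μ k : Measure (characterSpace ℂ C))) :
      ‖∑ k : Fin 4, Complex.I ^ (k : ℕ) * ∫ χ, u χ ∂(μ k : Measure (characterSpace ℂ C)) -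
        ∑ k : Fin 4, Complex.I ^ (k : ℕ) * ∫ χ, v χ ∂(μ k : Measure (characterSpace ℂ C))‖ ≤
      ∫ χ, ‖u χ - v χ‖ ∂(∑ k, (μ k : Measure (characterSpace ℂ C))) := by
    have hi (k : Fin 4) : Integrable (fun χ => ‖u χ - v χ‖)
        (μ k : Measure (characterSpace ℂ C)) := ((hu k).sub (hv k)).norm
    rw [integral_finsetSum_measure fun k _ => hi k, ← Finset.sum_sub_distrib]
    refine norm_sum_le_of_le _ fun k _ => ?_
    rw [← mul_sub, ← integral_sub (hu k) (hv k), norm_mul, norm_pow, Complex.norm_I, one_pow,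
      one_mul]
    exact norm_integral_le_integral_norm _
  -- The coefficients `I ^ k` have modulus one, so the sum of the four positive measures
  -- representing `ψ` dominates.
  refine ⟨∑ k, (μ k : Measure (characterSpace ℂ C)), inferInstance, fun f g => ?_, fun f a => ?_⟩
  · rw [borelBidual_apply f ψ μ hμ, borelBidual_apply g ψ μ hμ]
    exact key _ _ (fun k => integrable_borel f _) fun k => integrable_borel g _
  · rw [borelBidual_apply f ψ μ hμ, hμ a]
    exact key _ _ (fun k => integrable_borel f _) fun k => integrable_char a _

theorem exists_isCompact_integral_indicator_sub_le (g : BoundedBorel (characterSpace ℂ C))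
    {s : Set (characterSpace ℂ C)} (hs : MeasurableSet s) (ν : Measure (characterSpace ℂ C))
    [IsFiniteMeasure ν] {δ : ℝ} (hδ : 0 < δ) :
    ∃ (L : Set (characterSpace ℂ C)) (hL : IsCompact L), L ⊆ s ∧
      ∫ χ, ‖g.indicator hs χ - g.indicator hL.measurableSet χ‖ ∂ν ≤ δ := by
  -- The summand `1` avoids division by zero when `g = 0`.
  have hpos : 0 < δ / (‖g‖ + 1) := by positivity
  obtain ⟨L, hLs, hL, hν⟩ := hs.exists_isCompact_sdiff_lt (measure_ne_top ν s)
    (ε := ENNReal.ofReal (δ / (‖g‖ + 1))) (by simpa using hpos)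
  refine ⟨L, hL, hLs, ?_⟩
  have hm : MeasurableSet (s \ L) := hs.diff hL.measurableSet
  have hle (χ : characterSpace ℂ C) : ‖g.indicator hs χ - g.indicator hL.measurableSet χ‖ ≤
      (s \ L).indicator (fun _ => ‖g‖) χ := by
    rw [BoundedBorel.indicator_apply, BoundedBorel.indicator_apply]
    by_cases h1 : χ ∈ L
    · simp [h1, hLs h1]
    · by_cases h2 : χ ∈ s
      · simpa [h1, h2] using g.norm_apply_le χ
      · simp [h1, h2]
  have hreal : ν.real (s \ L) ≤ δ / (‖g‖ + 1) := ENNReal.toReal_le_of_le_ofReal hpos.le hν.le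
  calc _ ≤ ∫ χ, (s \ L).indicator (fun _ => ‖g‖) χ ∂ν :=
        integral_mono_of_nonneg (ae_of_all _ fun _ => norm_nonneg _)
          ((integrable_const _).indicator hm) (ae_of_all _ hle)
    _ = ν.real (s \ L) * ‖g‖ := by rw [integral_indicator_const _ hm, smul_eq_mul]
    _ ≤ δ / (‖g‖ + 1) * (‖g‖ + 1) :=
        mul_le_mul hreal (by linarith) (norm_nonneg _) hpos.le
    _ = δ := div_mul_cancel₀ _ (by positivity)

/-- A positive bounded Borel function supported in a compact set is approximated in `L¹` by
positive elements which are supported in a given neighbourhood. -/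
theorem exists_star_mul_self_integral_sub_le {g : BoundedBorel (characterSpace ℂ C)} (hg : 0 ≤ g)
    {L V : Set (characterSpace ℂ C)} (hL : IsCompact L) (hV : IsOpen V) (hLV : L ⊆ V)
    (ν : Measure (characterSpace ℂ C)) [IsFiniteMeasure ν] {δ : ℝ} (hδ : 0 < δ) :
    ∃ b : C, ‖star b * b‖ ≤ ‖g‖ ∧ (∀ χ ∉ V, (χ : characterSpace ℂ C) (star b * b) = 0) ∧
      ∫ χ, ‖g.indicator hL.measurableSet χ - χ (star b * b)‖ ∂ν ≤ δ := by
  have hg0 (χ : characterSpace ℂ C) : 0 ≤ (g χ).re := (Complex.le_def.1 (hg χ)).1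
  have hgr (χ : characterSpace ℂ C) : g χ = ((g χ).re : ℂ) :=
    Complex.ext rfl (Complex.le_def.1 (hg χ)).2.symm
  have hgn (χ : characterSpace ℂ C) : (g χ).re ≤ ‖g‖ :=
    (Complex.re_le_norm _).trans (g.norm_apply_le χ)
  obtain ⟨h, -, hint, hcont, hi⟩ := ((integrable_borel g ν).re.indicator
    hL.measurableSet).exists_hasCompactSupport_integral_sub_le hδ
  obtain ⟨u, hu1, hu0, hus, hu⟩ := exists_continuous_one_zero_of_isCompact hL hV.isClosed_compl
    (Set.disjoint_compl_right_iff_subset.2 hLV)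
  -- Clamping `h` to `[0, ‖g‖]` does not increase its distance to `g` on `L`, where `u = 1`. Off `L`
  -- the target is zero and `r ≤ |h|`. The cutoff `u` forces `r` to vanish off `V` and to have
  -- compact support.
  let r : characterSpace ℂ C → ℝ := fun χ => u χ * min (max (h χ) 0) ‖g‖
  have hmin (χ : characterSpace ℂ C) : 0 ≤ min (max (h χ) 0) ‖g‖ :=
    le_min (le_max_right _ _) (norm_nonneg _)
  have hr0 (χ : characterSpace ℂ C) : 0 ≤ r χ := mul_nonneg (hu χ).1 (hmin χ)
  have hrg (χ : characterSpace ℂ C) : r χ ≤ ‖g‖ :=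
    (mul_le_of_le_one_left (hmin χ) (hu χ).2).trans (min_le_right _ _)
  -- Taking the square root of `r` displays the approximant as `star b * b`, which is positive in
  -- any algebra containing `C`.
  obtain ⟨b, hb⟩ := exists_char_eq (fun χ => ((√(r χ) : ℝ) : ℂ)) (by fun_prop)
    (hus.mono fun χ hχ => by
      contrapose! hχ
      simp only [Function.mem_support, not_not] at hχ ⊢
      simp [r, hχ])
  have hbb (χ : characterSpace ℂ C) : χ (star b * b) = (r χ : ℂ) := by
    rw [char_mul, char_star, hb, Complex.conj_ofReal, ← Complex.ofReal_mul,
      Real.mul_self_sqrt (hr0 χ)]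
  refine ⟨b, norm_le_of_char (norm_nonneg _) fun χ => ?_, fun χ hχ => ?_, ?_⟩
  · rw [hbb, Complex.norm_real, Real.norm_of_nonneg (hr0 χ)]
    exact hrg χ
  · have : u χ = 0 := hu0 hχ
    simp [hbb, r, this]
  · refine (integral_mono_of_nonneg (ae_of_all _ fun _ => norm_nonneg _) ?_
      (ae_of_all _ fun χ => ?_)).trans hint
    · exact (((integrable_borel g ν).re.indicator hL.measurableSet).sub hi).norm
    · beta_reduce
      rw [hbb, BoundedBorel.indicator_apply]
      by_cases hχ : χ ∈ L
      · have hu1' : u χ = 1 := hu1 hχ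
        simp only [Set.indicator_of_mem hχ]
        rw [hgr, ← Complex.ofReal_sub, Complex.norm_real]
        have h0 := hg0 χ
        have h1 := hgn χ
        have : r χ = min (max (h χ) 0) ‖g‖ := by simp [r, hu1']
        simp only [this, RCLike.re_to_complex, Real.norm_eq_abs, Complex.ofReal_re]
        rcases max_cases (h χ) 0 with ⟨e, _⟩ | ⟨e, _⟩ <;> rw [e] <;>
        rcases min_cases (h χ) ‖g‖ with ⟨e', _⟩ | ⟨e', _⟩ <;>
        rcases min_cases 0 ‖g‖ with ⟨e'', _⟩ | ⟨e'', _⟩ <;> simp only [e', e''] <;>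
        rcases abs_cases ((g χ).re - h χ) with ⟨e3, _⟩ | ⟨e3, _⟩ <;> rw [e3] <;>
        refine abs_le.2 ⟨?_, ?_⟩ <;> linarith
      · simp only [Set.indicator_of_notMem hχ, zero_sub, norm_neg, Complex.norm_real,
          Real.norm_of_nonneg (hr0 χ)]
        calc r χ ≤ min (max (h χ) 0) ‖g‖ := mul_le_of_le_one_left (hmin χ) (hu χ).2
          _ ≤ max (h χ) 0 := min_le_left _ _
          _ ≤ ‖h χ‖ := max_le (le_abs_self _) (norm_nonneg _)

/-! ### Uniform compact approximation over a ball of functionals -/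

variable {B : Type*} [NonUnitalCStarAlgebra B]

/-- A positive bounded Borel function `g` can be replaced by its restriction to a compact set,
uniformly for the functionals `c ↦ ξ (b (φ c))` with `b` in a ball. -/
theorem exists_isCompact_forall_norm_sub_le (φ : C →L[ℂ] B) (ξ : StrongDual ℂ B)
    {g : BoundedBorel (characterSpace ℂ C)} (hg : 0 ≤ g) {R δ : ℝ} (hR : 0 ≤ R) (hδ : 0 < δ) :
    ∃ (L : Set (characterSpace ℂ C)) (hL : IsCompact L), L ⊆ {χ | g χ ≠ 0} ∧
      ∀ b : B, ‖b‖ ≤ R →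
        ‖borelBidual C g ((ξ.comp (ContinuousLinearMap.mul ℂ B b)).comp φ) -
          borelBidual C (g.indicator hL.measurableSet)
            ((ξ.comp (ContinuousLinearMap.mul ℂ B b)).comp φ)‖ ≤ δ := by
  by_contra! hcon
  let β (b : B) : StrongDual ℂ C := (ξ.comp (ContinuousLinearMap.mul ℂ B b)).comp φ
  -- Exhaustion: given finitely many such pairs, the union of their compact sets is not good enough
  -- for some `b`, so `g` restricted to the rest of its support pairs to more than `δ`. Inner
  -- regularity, for a measure depending on `b`, keeps `δ / 2` of this on a compact set disjoint
  -- from the previous ones.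
  let P : B × TopologicalSpace.Compacts (characterSpace ℂ C) → Prop := fun p => ‖p.1‖ ≤ R ∧
    (p.2 : Set (characterSpace ℂ C)) ⊆ {χ | g χ ≠ 0} ∧
      δ / 2 ≤ ‖borelBidual C (g.indicator p.2.isCompact.measurableSet) (β p.1)‖
  let r : B × TopologicalSpace.Compacts (characterSpace ℂ C) →
      B × TopologicalSpace.Compacts (characterSpace ℂ C) → Prop := fun p q =>
    Disjoint (p.2 : Set (characterSpace ℂ C)) q.2
  have hsymm : Std.Symm r := ⟨fun _ _ h => Disjoint.symm h⟩
  obtain ⟨p, hp, hpr⟩ := exists_seq_of_forall_finset_exists' P r (by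
    intro s hs
    let L : Set (characterSpace ℂ C) := ⋃ q ∈ s, (q.2 : Set (characterSpace ℂ C))
    have hL : IsCompact L := s.isCompact_biUnion fun q _ => q.2.isCompact
    have hLg : L ⊆ {χ | g χ ≠ 0} := Set.iUnion₂_subset fun q hq => (hs q hq).2.1
    obtain ⟨b, hb, hb'⟩ := hcon L hL hLg
    obtain ⟨ν, _, hν, -⟩ := exists_dominating_measure (β b)
    have hE : MeasurableSet ({χ | g χ ≠ 0} \ L) := g.measurableSet_support.diff hL.measurableSet
    obtain ⟨M, hM, hMs, hMν⟩ :=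
      exists_isCompact_integral_indicator_sub_le g hE ν (half_pos hδ)
    refine ⟨(b, ⟨M, hM⟩), ⟨hb, hMs.trans Set.sdiff_subset, ?_⟩, fun q hq => ?_⟩
    · have h1 := (hν _ _).trans hMν
      have h2 : g.indicator hE = g - g.indicator hL.measurableSet := by
        rw [eq_sub_iff_add_eq]
        refine Subtype.ext (lp.ext (funext fun χ => ?_))
        change g.indicator hE χ + g.indicator hL.measurableSet χ = g χ
        rw [BoundedBorel.indicator_apply, BoundedBorel.indicator_apply]
        by_cases h1 : χ ∈ L
        · simp [h1]
        · by_cases h2 : g χ = 0 <;> simp [h1, h2]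
      rw [h2, map_sub, sub_apply] at h1
      have h3 := norm_le_norm_add_norm_sub' (borelBidual C g (β b) -
        borelBidual C (g.indicator hL.measurableSet) (β b))
        (borelBidual C (g.indicator hM.measurableSet) (β b))
      change δ / 2 ≤ ‖borelBidual C (g.indicator hM.measurableSet) (β b)‖
      have h4 : δ < ‖borelBidual C g (β b) -
        borelBidual C (g.indicator hL.measurableSet) (β b)‖ := hb'
      linarith
    · refine Set.disjoint_left.2 fun χ hχ hχ' => (hMs hχ').2 ?_
      exact Set.mem_biUnion hq hχ)
  have bound (N : ℕ) :
      (N : ℝ) * (δ / 4) ≤ ‖ξ‖ * (√((N : ℝ) * R ^ 2) * (‖φ‖ * ‖g‖)) := by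
    -- Finitely many disjoint compact sets have disjoint open neighbourhoods; this is why the
    -- sequence is truncated at `N`.
    have hd : Pairwise (Function.onFun Disjoint
        fun i : Fin N => nhdsSet ((p i).2 : Set (characterSpace ℂ C))) := fun i j hij =>
      separatedNhds_iff_disjoint.1 (SeparatedNhds.of_isCompact_isCompact (p i).2.isCompact
        (p j).2.isCompact (hpr (Fin.val_injective.ne hij)))
    obtain ⟨V, hV, hVd⟩ := hd.exists_mem_filter_basis_of_disjoint fun i => hasBasis_nhdsSet _
    have hc (i : Fin N) : ∃ c : C, ‖c‖ ≤ ‖g‖ ∧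
        (∀ χ ∉ V i, (χ : characterSpace ℂ C) c = 0) ∧ δ / 4 ≤ ‖ξ ((p i).1 * φ c)‖ := by
      -- Passing from the Borel function to an element of `C` costs `δ / 4` of the lower bound `δ /
      -- 2`.
      obtain ⟨ν, _, -, hν⟩ := exists_dominating_measure (β (p i).1)
      obtain ⟨b, hb1, hb2, hb3⟩ := exists_star_mul_self_integral_sub_le hg (p i).2.isCompact
        (hV i).1 (hV i).2 ν (show 0 < δ / 4 by positivity)
      refine ⟨star b * b, hb1, hb2, ?_⟩
      have h1 := (hν _ _).trans hb3
      have h2 := (hp i).2.2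
      have h3 := norm_le_norm_add_norm_sub' (borelBidual C
        (g.indicator (p i).2.isCompact.measurableSet) (β (p i).1)) (β (p i).1 (star b * b))
      change δ / 4 ≤ ‖β (p i).1 (star b * b)‖
      linarith
    choose c hc1 hc2 hc3 using hc
    have := card_mul_le_of_norm_sum_zsmul_le ξ (fun i : Fin N => (p i).1) (fun i => φ (c i))
      (M := ‖φ‖ * ‖g‖) (by positivity) (fun i => (hp i).1) (fun e => ?_) hc3
    · simpa using this
    · have : ∑ i, (e i : ℤ) • φ (c i) = φ (∑ i, (e i : ℤ) • c i) := by
        simp only [map_sum, map_zsmul]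
      rw [this]
      exact φ.le_opNorm_of_le
        (norm_sum_zsmul_le_of_disjoint c V hVd (norm_nonneg _) hc1 hc2 e)
  obtain ⟨n, hn⟩ := exists_nat_gt (‖ξ‖ * (R * (‖φ‖ * ‖g‖)) / (δ / 4))
  rw [div_lt_iff₀ (by positivity)] at hn
  have hn0 : 0 < (n : ℝ) := by
    by_contra! h
    have : 0 ≤ ‖ξ‖ * (R * (‖φ‖ * ‖g‖)) := by positivity
    nlinarith
  -- With `n ^ 2` sets the square root is exact, and the bound becomes `n * (δ / 4) ≤ ‖ξ‖ * R * ‖φ‖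
  -- * ‖g‖`, contrary to the choice of `n`.
  have := bound (n ^ 2)
  rw [Nat.cast_pow, ← mul_pow, Real.sqrt_sq (by positivity)] at this
  nlinarith

end Approximation

/-! ### Order zero maps on bounded Borel functions -/

/-- Elements with disjoint supports are orthogonal. -/
theorem orthogonal_of_disjoint {C : Type*} [NonUnitalCommCStarAlgebra C] {a c : C}
    {U V : Set (characterSpace ℂ C)} (hUV : Disjoint U V)
    (ha : ∀ χ ∉ U, (χ : characterSpace ℂ C) a = 0) (hc : ∀ χ ∉ V, (χ : characterSpace ℂ C) c = 0) :
    Orthogonal a c := by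
  have h (χ : characterSpace ℂ C) : χ a = 0 ∨ χ c = 0 := by
    by_cases hχ : χ ∈ U
    · exact .inr (hc χ (Set.disjoint_left.1 hUV hχ))
    · exact .inl (ha χ hχ)
  refine ⟨?_, ?_, ?_, ?_⟩ <;> refine eq_of_char fun χ => ?_ <;>
    rcases h χ with h | h <;> simp [char_mul, char_star, h]

theorem BoundedBorel.disjoint_support {X : Type*} [MeasurableSpace X] {f g : BoundedBorel X}
    (h : Orthogonal f g) : Disjoint {x | f x ≠ 0} {x | g x ≠ 0} := by
  refine Set.disjoint_left.2 fun x hf hg => mul_ne_zero hf hg ?_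
  exact congrArg (fun k : BoundedBorel X => k x) h.1

theorem proposition4p1 {A B : Type*} [NonUnitalCStarAlgebra A] [PartialOrder A] [StarOrderedRing A]
    [NonUnitalCStarAlgebra B] (ε : ℝ) (hε : 0 ≤ ε) (φ : A →L[ℂ] B) (hφ : IsEpsOrderZero ε φ)
    (A₀ : NonUnitalStarSubalgebra ℂ A) [IsClosed (A₀ : Set A)] [IsMulCommutative A₀]
    [TopologicalSpace.SeparableSpace A₀] :
    IsEpsOrderZero (A := BoundedBorel (WeakDual.characterSpace ℂ A₀)) (E := Bidual B) ε
      (φ.bidual.comp (borelInclusion A₀)) := by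
  intro f g hf hg hfg
  refine ContinuousLinearMap.opNorm_le_bound _ (by positivity) fun ξ => ?_
  let ι : A₀ →L[ℂ] A := ⟨A₀.subtype, continuous_subtype_val⟩
  let β (b : B) : StrongDual ℂ A₀ := (ξ.comp (ContinuousLinearMap.mul ℂ B b)).comp (φ.comp ι)
  let Ψ : StrongDual ℂ A₀ :=
    ((arensAct ((φ.bidual.comp (borelInclusion A₀)) g) ξ).comp φ).comp ι
  -- By definition of the Arens product and of the second adjoint, the product at `ξ` is `f` paired
  -- with `Ψ`, and `Ψ a` is `g` paired with `β (φ (ι a))`.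
  change ‖borelBidual A₀ f Ψ‖ ≤ _
  refine le_of_forall_pos_le_add fun δ hδ => ?_
  have hδ4 : 0 < δ / 4 := by positivity
  obtain ⟨ν, _, hν, hν'⟩ := exists_dominating_measure Ψ
  obtain ⟨P, hP, hPf, hPν⟩ :=
    exists_isCompact_integral_indicator_sub_le f f.measurableSet_support ν hδ4
  rw [f.indicator_support] at hPν
  -- `L` is fixed before `a`: the radius `‖φ‖ * ‖f‖` bounds `φ (ι (star a * a))` for every
  -- admissible `a`.
  obtain ⟨L, hL, hLg, hLu⟩ := exists_isCompact_forall_norm_sub_le (φ.comp ι) ξ hg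
    (R := ‖φ‖ * ‖f‖) (by positivity) hδ4
  obtain ⟨U, V, hU, hV, hPU, hLV, hUV⟩ := SeparatedNhds.of_isCompact_isCompact hP hL
    ((BoundedBorel.disjoint_support hfg).mono hPf hLg)
  obtain ⟨a, ha, haU, haν⟩ := exists_star_mul_self_integral_sub_le hf hP hU hPU ν hδ4
  -- The measure `ρ` depends on `a`, which is harmless now that `L` and `V` are fixed.
  obtain ⟨ρ, _, -, hρ⟩ := exists_dominating_measure (β (φ (ι (star a * a))))
  obtain ⟨c, hc, hcV, hcρ⟩ := exists_star_mul_self_integral_sub_le hg hL hV hLV ρ hδ4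
  have h1 := (hν _ _).trans hPν
  have h2 := (hν' _ _).trans haν
  have h3 := hLu (φ (ι (star a * a))) (φ.le_opNorm_of_le ha)
  have h4 := (hρ _ _).trans hcρ
  have h5 : ‖β (φ (ι (star a * a))) (star c * c)‖ ≤ ε * ‖f‖ * ‖g‖ * ‖ξ‖ := by
    obtain ⟨o1, o2, o3, o4⟩ := orthogonal_of_disjoint hUV haU hcV
    have ho := hφ (ι (star a * a)) (ι (star c * c)) (star_mul_self_nonneg (a : A))
      (star_mul_self_nonneg (c : A)) ⟨congrArg Subtype.val o1, congrArg Subtype.val o2,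
        congrArg Subtype.val o3, congrArg Subtype.val o4⟩
    calc _ ≤ ‖ξ‖ * ‖φ (ι (star a * a)) * φ (ι (star c * c))‖ := ξ.le_opNorm _
      _ ≤ ‖ξ‖ * (ε * ‖f‖ * ‖g‖) := by
        refine mul_le_mul_of_nonneg_left (ho.trans ?_) (norm_nonneg _)
        exact mul_le_mul (mul_le_mul_of_nonneg_left ha hε) hc (norm_nonneg _) (by positivity)
      _ = _ := mul_comm _ _
  -- The five numbers are `f` at `Ψ`, `f` cut to `P` at `Ψ`, `Ψ (star a * a)`, which is also `g` at
  -- `β (φ (ι (star a * a)))`, then `g` cut to `L` at that functional, and finally `ξ (φ (ι (star a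
  -- * a)) * φ (ι (star c * c)))`.
  have triangle (q₀ q₁ q₂ q₃ q₄ : ℂ) {M : ℝ} (h1 : ‖q₀ - q₁‖ ≤ δ / 4) (h2 : ‖q₁ - q₂‖ ≤ δ / 4)
      (h3 : ‖q₂ - q₃‖ ≤ δ / 4) (h4 : ‖q₃ - q₄‖ ≤ δ / 4) (h5 : ‖q₄‖ ≤ M) : ‖q₀‖ ≤ M + δ := by
    have := norm_add_le_of_le (norm_add_le_of_le (norm_add_le_of_le (norm_add_le_of_le h1 h2) h3)
      h4) h5
    rw [show q₀ - q₁ + (q₁ - q₂) + (q₂ - q₃) + (q₃ - q₄) + q₄ = q₀ by ring] at this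
    linarith
  exact triangle _ _ _ _ _ h1 h2 h3 h4 h5

end
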